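/- **Lemma A.1.** Let $F$ be a probability distribution (the prior) on $[0,1]$ with mean $\pi\in(0,1)$, and let $r^*\in(0,1)$. Identify distributions on $[0,1]$ with their cdfs. Call $G$ a *mean-preserving contraction* (MPC) of $H$ if $\int_0^x G(q)\,dq\le\int_0^x H(q)\,dq$ for all $x\in[0,1]$, with equality at $x=1$. Let $$\mathcal G=\{G \text{ on } [0,1] : G \text{ is an MPC of } F\},\qquad \mathcal T=\{T \text{ on } [0,1] : T \text{ is an MPC of } (1-r^*)\delta_0+r^*\delta_1\},$$ and $$u(G,T)=\int\!\!\int \mathbf 1(q>r)\,dG(q)\,dT(r)$$ (ties are broken against Sender). In the *MPC game*, Sender and Nature simultaneously choose $G\in\mathcal G$ and $T\in\mathcal T$, with payoffs $u(G,T)$ and $-u(G,T)$. The pair $(G^*,T^*)\in\mathcal G\times\mathcal T$ is a Nash equilibrium if neither player gains by deviating within her own choice set, and $G^*$ is then called a Nash equilibrium strategy for Sender. The *maxmin persuasion problem* is $$\max_{G\in\mathcal G}\ \min_{T\in\mathcal M} u(G,T),\qquad \mathcal M=\Big\{T \text{ on } [0,1] : \int r\,dT(r)=r^*\Big\}.$$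 1. $G^*\in\mathcal G$ is a Nash equilibrium strategy for Sender in the MPC game if and only if $G^*$ solves the maxmin persuasion problem. 2. For every $G\in\mathcal G$ the minimum of $u(G,\cdot)$ over $\mathcal M$ is attained, the outer maximum over $\mathcal G$ and the outer minimum over $\mathcal T$ below are attained, and the maxmin and minmax values coincide: $$\max_{G\in\mathcal G}\ \min_{T\in\mathcal M}u(G,T)=\min_{T\in\mathcal T}\ \sup_{G\in\mathcal G}u(G,T).$$ -/

import Mathlib

open MeasureTheory

noncomputable section

namespace MaxminPersuasion

/-- A distribution on `[0, 1]`; equivalently, a cdf over `[0, 1]`. -/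
abbrev Dist : Type := ProbabilityMeasure unitInterval

/-- The cdf of a distribution on `[0, 1]`, as a function on the real line. -/
def cdfOf (G : Dist) (x : ℝ) : ℝ :=
  ProbabilityTheory.cdf ((G : Measure unitInterval).map (fun q : unitInterval => (q : ℝ))) x

/-- The mean of a distribution on `[0, 1]`. -/
def mean (G : Dist) : ℝ := ∫ q : unitInterval, (q : ℝ) ∂(G : Measure unitInterval)

/-- `G` is a mean-preserving contraction of `F`, in the integral-of-cdf form. -/
def IsMPC (G F : Dist) : Prop :=
  (∀ x ∈ Set.Icc (0 : ℝ) 1, ∫ q in (0 : ℝ)..x, cdfOf G q ≤ ∫ q in (0 : ℝ)..x, cdfOf F q) ∧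
    ∫ q in (0 : ℝ)..1, cdfOf G q = ∫ q in (0 : ℝ)..1, cdfOf F q

/-- The binary distribution `(1 - r) δ₀ + r δ₁`. -/
def binary (r : unitInterval) : Dist :=
  ⟨ENNReal.ofReal (1 - (r : ℝ)) • Measure.dirac (0 : unitInterval) +
      ENNReal.ofReal (r : ℝ) • Measure.dirac (1 : unitInterval), ⟨by
    simp [← ENNReal.ofReal_add (sub_nonneg.2 r.2.2) r.2.1]⟩⟩

/-- Sender's choice set: the mean-preserving contractions of the prior `F`. -/
def senderChoices (F : Dist) : Set Dist := {G | IsMPC G F}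

/-- Nature's choice set in the game: the mean-preserving contractions of
`(1 - r) δ₀ + r δ₁`. -/
def natureChoices (r : unitInterval) : Set Dist := {T | IsMPC T (binary r)}

/-- The Receiver type distributions Sender considers possible in the maxmin problem:
all those with mean `r`. -/
def typeDists (r : unitInterval) : Set Dist := {T | mean T = (r : ℝ)}

/-- Sender's payoff `∫ ∫ 1(q > r) dG(q) dT(r)`; a tie `q = r` is lost by Sender. -/
def senderPayoff (G T : Dist) : ℝ :=
  ∫ r : unitInterval, (∫ q : unitInterval, (if q > r then (1 : ℝ) else 0)
    ∂(G : Measure unitInterval)) ∂(T : Measure unitInterval)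

/-- Nature's payoff in the zero-sum game. -/
def naturePayoff (G T : Dist) : ℝ := - senderPayoff G T

/-- `(G, T)` is a Nash equilibrium of the simultaneous-move game: both strategies are feasible
and each is a best response to the other. -/
structure IsNash (F : Dist) (r : unitInterval) (G T : Dist) : Prop where
  sender_mem : G ∈ senderChoices F
  nature_mem : T ∈ natureChoices r
  sender_best : ∀ G' ∈ senderChoices F, senderPayoff G' T ≤ senderPayoff G T
  nature_best : ∀ T' ∈ natureChoices r, naturePayoff G T' ≤ naturePayoff G T

/-- `G` is a Nash equilibrium strategy for Sender. -/
def IsSenderNashStrategy (F : Dist) (r : unitInterval) (G : Dist) : Prop :=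
  ∃ T : Dist, IsNash F r G T

/-- Sender's worst-case payoff from `G` over all type distributions with mean `r`. -/
def worstPayoff (r : unitInterval) (G : Dist) : ℝ := sInf (senderPayoff G '' typeDists r)

/-- The highest payoff (as a supremum) that Sender can get against `T`. -/
def bestPayoff (F : Dist) (T : Dist) : ℝ :=
  sSup ((fun G => senderPayoff G T) '' senderChoices F)

/-- `G` solves the maxmin persuasion problem: it maximizes the worst-case payoff over
Sender's choice set. -/
def SolvesMaxmin (F : Dist) (r : unitInterval) (G : Dist) : Prop :=
  G ∈ senderChoices F ∧ ∀ G' ∈ senderChoices F, worstPayoff r G' ≤ worstPayoff r G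

end MaxminPersuasion

end

/-!
The payoff `u(G, T) = ∫ G(r, 1] dT(r)` is bilinear, and both choice sets are convex and weakly
compact. Nature's choice set in the game is the set of *all* distributions with mean `r`
(`natureChoices_eq_typeDists`), so both problems have the same pairs of strategies, and the claims
follow from the existence of a saddle point (`exists_saddlePoint`).

Because Sender loses ties, `u` is lower semicontinuous in either variable, which is the right
property for Nature, who minimizes, and the wrong one for Sender. Two facts make up for this.

* The minimax inequality of Fan type (`exists_forall_le_senderPayoff`) uses no topology on Sender's
  side. By compactness of Nature's set, finitely many strategies of Sender suffice to get more than
  `c` against every `T`, and a separating hyperplane in the space of their payoff vectors provides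
  weights with which to mix them. It yields strategies that guarantee Sender the minmax value up
  to `ε`.
* Guarantees against all distributions with mean `r` do pass to weak limits
  (`le_senderPayoff_of_tendsto`), so that the maxmin value is attained. Given `T`, Nature can play
  a nearby distribution in which every type but `1` is moved slightly to the right and a little
  mass at `0` restores the mean. Against the moved types Sender's payoff is controlled by closed
  half-lines, on which mass is upper semicontinuous, and the type `1` is never beaten at all.
-/

namespace MaxminPersuasion

open Set Filter Topology

/-! ### The payoff -/

lemma integrable_of_bounded (μ : Measure unitInterval) [IsFiniteMeasure μ] {f : unitInterval → ℝ}
    (hf : Measurable f) (C : ℝ) (hC : ∀ q, |f q| ≤ C) : Integrable f μ :=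
  Integrable.of_bound hf.aestronglyMeasurable C (Eventually.of_forall hC)

lemma measurable_real_Ioi (G : Dist) :
    Measurable fun r : unitInterval => (G : Measure unitInterval).real (Ioi r) :=
  Antitone.measurable fun _ _ h => measureReal_mono (Ioi_subset_Ioi h)

lemma integrable_real_Ioi (G : Dist) (μ : Measure unitInterval) [IsFiniteMeasure μ] :
    Integrable (fun r : unitInterval => (G : Measure unitInterval).real (Ioi r)) μ :=
  integrable_of_bounded μ (measurable_real_Ioi G) 1 fun r => by
    rw [abs_of_nonneg measureReal_nonneg]; exact measureReal_le_one

lemma senderPayoff_eq_integral (G T : Dist) :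
    senderPayoff G T =
      ∫ r, (G : Measure unitInterval).real (Ioi r) ∂(T : Measure unitInterval) := by
  unfold senderPayoff
  congr 1 with r
  have : (fun q : unitInterval => if q > r then (1 : ℝ) else 0) = (Ioi r).indicator 1 := by
    ext q; simp [indicator_apply]
  rw [this, integral_indicator_one measurableSet_Ioi]

lemma senderPayoff_nonneg (G T : Dist) : 0 ≤ senderPayoff G T := by
  rw [senderPayoff_eq_integral]
  exact integral_nonneg fun _ => measureReal_nonneg

lemma senderPayoff_le_one (G T : Dist) : senderPayoff G T ≤ 1 := by
  rw [senderPayoff_eq_integral]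
  calc _ ≤ ∫ _, (1 : ℝ) ∂(T : Measure unitInterval) :=
        integral_mono (integrable_real_Ioi G _) (integrable_const _) fun _ => measureReal_le_one
    _ = 1 := by simp

lemma ofReal_senderPayoff (G T : Dist) :
    ENNReal.ofReal (senderPayoff G T) =
      ∫⁻ r, (G : Measure unitInterval) (Ioi r) ∂(T : Measure unitInterval) := by
  rw [senderPayoff_eq_integral,
    ofReal_integral_eq_lintegral_ofReal (integrable_real_Ioi G _)
      (Eventually.of_forall fun _ => measureReal_nonneg)]
  simp

/-- Ties are lost by Sender, so the winning region `{q > r}` is open; this is what makes the payoff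
lower semicontinuous. -/
lemma senderPayoff_eq_prod (G T : Dist) :
    senderPayoff G T = ((G.prod T : ProbabilityMeasure (unitInterval × unitInterval)) :
      Measure (unitInterval × unitInterval)).real {p | p.2 < p.1} := by
  have hO : MeasurableSet {p : unitInterval × unitInterval | p.2 < p.1} :=
    measurableSet_lt measurable_snd measurable_fst
  rw [← ENNReal.toReal_ofReal (senderPayoff_nonneg G T), ofReal_senderPayoff, measureReal_def,
    ProbabilityMeasure.toMeasure_prod, Measure.prod_apply_symm hO]
  rfl

lemma lowerSemicontinuous_senderPayoff (G : Dist) :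
    LowerSemicontinuous (senderPayoff G) := by
  intro T c hc
  rcases lt_or_ge c 0 with h0 | h0
  · exact Eventually.of_forall fun T' => h0.trans_le (senderPayoff_nonneg G T')
  have hO : IsOpen {p : unitInterval × unitInterval | p.2 < p.1} :=
    isOpen_lt continuous_snd continuous_fst
  have hcont : Tendsto (fun T' : Dist => G.prod T') (𝓝 T) (𝓝 (G.prod T)) :=
    (ProbabilityMeasure.continuous_prod.comp (Continuous.prodMk_right G)).tendsto T
  have hport := ProbabilityMeasure.le_liminf_measure_open_of_tendsto hcont hO
  have hlt := fun T' : Dist => ENNReal.ofReal_lt_iff_lt_toReal h0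
    (measure_ne_top (G.prod T' : Measure (unitInterval × unitInterval)) {p | p.2 < p.1})
  have := eventually_lt_of_lt_liminf
    (((hlt T).2 (by rw [senderPayoff_eq_prod] at hc; exact hc)).trans_le hport)
  filter_upwards [this] with T' h
  rw [senderPayoff_eq_prod]
  exact (hlt T').1 h

/-! ### Mixtures -/

/-- The mixture `∑ i, w i • G i` of distributions, for weights `w` in the standard simplex;
the truncation in `ENNReal.ofReal` is harmless since the weights are nonnegative. -/
noncomputable def mix {ι : Type*} [Fintype ι] (w : ι → ℝ) (hw : w ∈ stdSimplex ℝ ι)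
    (G : ι → Dist) : Dist :=
  ⟨∑ i, ENNReal.ofReal (w i) • (G i : Measure unitInterval), ⟨by
    simp [← ENNReal.ofReal_sum_of_nonneg fun i _ => hw.1 i, hw.2]⟩⟩

section Mix

variable {ι : Type*} [Fintype ι] {w : ι → ℝ} (hw : w ∈ stdSimplex ℝ ι) (G : ι → Dist)

lemma integral_mix {f : unitInterval → ℝ} (hf : ∀ i, Integrable f (G i : Measure unitInterval)) :
    ∫ q, f q ∂(mix w hw G : Measure unitInterval) =
      ∑ i, w i * ∫ q, f q ∂(G i : Measure unitInterval) := by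
  change ∫ q, f q ∂(∑ i, ENNReal.ofReal (w i) • (G i : Measure unitInterval)) = _
  rw [integral_finsetSum_measure fun i _ => (hf i).smul_measure ENNReal.ofReal_ne_top]
  simp [integral_smul_measure, hw.1]

lemma senderPayoff_mix_right (G₀ : Dist) :
    senderPayoff G₀ (mix w hw G) = ∑ i, w i * senderPayoff G₀ (G i) := by
  simp only [senderPayoff_eq_integral]
  exact integral_mix hw G fun i => integrable_real_Ioi _ _

lemma senderPayoff_mix_left (T : Dist) :
    senderPayoff (mix w hw G) T = ∑ i, w i * senderPayoff (G i) T := by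
  have h : ∀ r : unitInterval, (mix w hw G : Measure unitInterval).real (Ioi r) =
      ∑ i, w i * (G i : Measure unitInterval).real (Ioi r) := fun r => by
    have := integral_mix hw G (f := (Ioi r).indicator 1) fun i =>
      (integrable_const (1 : ℝ)).indicator measurableSet_Ioi
    simpa only [integral_indicator_one measurableSet_Ioi] using this
  simp only [senderPayoff_eq_integral, h]
  rw [integral_finsetSum _ fun i _ => (integrable_real_Ioi _ _).const_mul _]
  simp only [integral_const_mul]

end Mix

/-! ### Mean-preserving contractions -/

lemma integrable_of_continuous (μ : Measure unitInterval) [IsFiniteMeasure μ]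
    {f : unitInterval → ℝ} (hf : Continuous f) : Integrable f μ :=
  hf.integrable_of_hasCompactSupport (HasCompactSupport.of_compactSpace f)

lemma continuous_stopLoss (x : ℝ) : Continuous fun q : unitInterval => max (x - (q : ℝ)) 0 := by
  fun_prop

lemma continuous_integral_dist {f : unitInterval → ℝ} (hf : Continuous f) :
    Continuous fun G : Dist => ∫ q, f q ∂(G : Measure unitInterval) :=
  ProbabilityMeasure.continuous_integral_continuousMap (⟨f, hf⟩ : C(unitInterval, ℝ))

/-- Integrating the cdf gives the lower partial moment `∫ (x - q)⁺ dG(q)`; in this form the order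
of mean-preserving contractions is visibly linear and weakly continuous in `G`. -/
lemma integral_cdfOf (G : Dist) {x : ℝ} (hx : 0 ≤ x) :
    ∫ q in (0 : ℝ)..x, cdfOf G q = ∫ q, max (x - (q : ℝ)) 0 ∂(G : Measure unitInterval) := by
  have hcdf : ∀ y : ℝ, cdfOf G y =
      ∫ q, (if (q : ℝ) ≤ y then (1 : ℝ) else 0) ∂(G : Measure unitInterval) := fun y => by
    have : IsProbabilityMeasure
        ((G : Measure unitInterval).map (fun q : unitInterval => (q : ℝ))) :=
      Measure.isProbabilityMeasure_map measurable_subtype_coe.aemeasurable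
    have hms : MeasurableSet {q : unitInterval | (q : ℝ) ≤ y} :=
      measurableSet_le measurable_subtype_coe measurable_const
    have hind : (fun q : unitInterval => if (q : ℝ) ≤ y then (1 : ℝ) else 0) =
        {q : unitInterval | (q : ℝ) ≤ y}.indicator 1 := by
      ext q; simp [indicator_apply]
    rw [cdfOf, ProbabilityTheory.cdf_eq_real, measureReal_def,
      Measure.map_apply measurable_subtype_coe measurableSet_Iic, hind,
      integral_indicator_one hms]
    rfl
  have hmeas : MeasurableSet {p : ℝ × unitInterval | (p.2 : ℝ) ≤ p.1} :=
    measurableSet_le (measurable_subtype_coe.comp measurable_snd) measurable_fst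
  have hint : Integrable (Function.uncurry fun (y : ℝ) (q : unitInterval) =>
      if (q : ℝ) ≤ y then (1 : ℝ) else 0)
      ((volume.restrict (Ioc 0 x)).prod (G : Measure unitInterval)) := by
    refine Integrable.of_bound (Measurable.aestronglyMeasurable ?_) 1
      (Eventually.of_forall fun p => ?_)
    · exact Measurable.ite hmeas measurable_const measurable_const
    · simp only [Function.uncurry]; split_ifs <;> simp
  simp only [intervalIntegral.integral_of_le hx, hcdf]
  rw [integral_integral_swap hint]
  congr 1 with q
  have hind : (fun y : ℝ => if (q : ℝ) ≤ y then (1 : ℝ) else 0) = (Ici (q : ℝ)).indicator 1 := by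
    ext y; simp [indicator_apply]
  rw [hind, integral_indicator_one measurableSet_Ici, measureReal_def,
    Measure.restrict_apply measurableSet_Ici]
  -- `Ici q ∩ Ioc 0 x` is `Icc q x` up to the null point `0`
  have hae : (Ici (q : ℝ) ∩ Ioc 0 x : Set ℝ) =ᵐ[volume] (Ici (q : ℝ) ∩ Icc 0 x : Set ℝ) :=
    ae_eq_set_inter (ae_eq_refl _) Ioc_ae_eq_Icc
  have hset : (Ici (q : ℝ) ∩ Icc 0 x : Set ℝ) = Icc (q : ℝ) x := by
    ext y
    simp only [mem_inter_iff, mem_Ici, mem_Icc]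
    exact ⟨fun h => ⟨h.1, h.2.2⟩, fun h => ⟨h.1, q.2.1.trans h.1, h.2⟩⟩
  rw [measure_congr hae, hset, Real.volume_Icc, ENNReal.toReal_ofReal']

lemma isMPC_iff (G F : Dist) :
    IsMPC G F ↔
      (∀ x ∈ Icc (0 : ℝ) 1, ∫ q, max (x - (q : ℝ)) 0 ∂(G : Measure unitInterval) ≤
        ∫ q, max (x - (q : ℝ)) 0 ∂(F : Measure unitInterval)) ∧
      ∫ q, max (1 - (q : ℝ)) 0 ∂(G : Measure unitInterval) =
        ∫ q, max (1 - (q : ℝ)) 0 ∂(F : Measure unitInterval) := by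
  unfold IsMPC
  rw [integral_cdfOf G zero_le_one, integral_cdfOf F zero_le_one]
  refine and_congr_left fun _ => forall₂_congr fun x hx => ?_
  rw [integral_cdfOf G hx.1, integral_cdfOf F hx.1]

lemma integral_stopLoss_one (G : Dist) :
    ∫ q, max (1 - (q : ℝ)) 0 ∂(G : Measure unitInterval) = 1 - mean G := by
  have h : ∀ q : unitInterval, max (1 - (q : ℝ)) 0 = 1 - q := fun q =>
    max_eq_left (sub_nonneg.2 q.2.2)
  simp only [h, mean]
  rw [integral_sub (integrable_const _) (integrable_of_continuous _ continuous_subtype_val)]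
  simp

lemma integral_binary (r : unitInterval) {f : unitInterval → ℝ} (hf : Continuous f) :
    ∫ q, f q ∂(binary r : Measure unitInterval) = (1 - (r : ℝ)) * f 0 + r * f 1 := by
  have h0 := r.2.1
  have h1 := sub_nonneg.2 r.2.2
  change ∫ q, f q ∂(ENNReal.ofReal (1 - (r : ℝ)) • Measure.dirac (0 : unitInterval) +
      ENNReal.ofReal (r : ℝ) • Measure.dirac (1 : unitInterval)) = _
  rw [integral_add_measure
    ((integrable_of_continuous _ hf).smul_measure ENNReal.ofReal_ne_top)
    ((integrable_of_continuous _ hf).smul_measure ENNReal.ofReal_ne_top)]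
  simp [integral_smul_measure, h0, h1]

/-- Every distribution on `[0, 1]` with mean `r` is a mean-preserving contraction of the two-point
distribution on the end points with the same mean, because `(x - q)⁺ ≤ x * (1 - q)`. -/
lemma natureChoices_eq_typeDists (r : unitInterval) : natureChoices r = typeDists r := by
  have hb : ∀ x ∈ Icc (0 : ℝ) 1,
      ∫ q, max (x - (q : ℝ)) 0 ∂(binary r : Measure unitInterval) = (1 - (r : ℝ)) * x :=
    fun x hx => by
      rw [integral_binary r (continuous_stopLoss x)]
      simp [hx.1, hx.2]
  have hone : (1 : ℝ) ∈ Icc (0 : ℝ) 1 := ⟨zero_le_one, le_rfl⟩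
  ext T
  simp only [natureChoices, typeDists, mem_ofPred_eq, isMPC_iff, integral_stopLoss_one T, hb 1 hone]
  constructor
  · rintro ⟨-, h⟩; linarith
  · intro h
    refine ⟨fun x hx => ?_, by linarith⟩
    rw [hb x hx]
    calc ∫ q, max (x - (q : ℝ)) 0 ∂(T : Measure unitInterval)
        ≤ ∫ q, x * max (1 - (q : ℝ)) 0 ∂(T : Measure unitInterval) := by
          refine integral_mono (integrable_of_continuous _ (continuous_stopLoss x))
            ((integrable_of_continuous _ (continuous_stopLoss 1)).const_mul x) fun q => ?_
          have h0 := q.2.1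
          have h1 := q.2.2
          have h2 : max (1 - (q : ℝ)) 0 = 1 - q := max_eq_left (sub_nonneg.2 h1)
          simp only [h2]
          exact max_le (by nlinarith [hx.2]) (mul_nonneg hx.1 (sub_nonneg.2 h1))
      _ = (1 - (r : ℝ)) * x := by
          rw [integral_const_mul, integral_stopLoss_one, h, mul_comm]

lemma isClosed_typeDists (r : unitInterval) : IsClosed (typeDists r) :=
  isClosed_eq (continuous_integral_dist continuous_subtype_val) continuous_const

lemma mix_mem_typeDists {ι : Type*} [Fintype ι] {w : ι → ℝ} (hw : w ∈ stdSimplex ℝ ι)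
    {T : ι → Dist} {r : unitInterval} (hT : ∑ i, w i * mean (T i) = r) :
    mix w hw T ∈ typeDists r := by
  change mean _ = _
  rw [← hT]
  exact integral_mix hw T fun i => integrable_of_continuous _ continuous_subtype_val

lemma typeDists_nonempty (r : unitInterval) : (typeDists r).Nonempty :=
  ⟨⟨Measure.dirac r, inferInstance⟩, by
    change ∫ q : unitInterval, (q : ℝ) ∂(Measure.dirac r) = r
    simp⟩

lemma senderChoices_nonempty (F : Dist) : (senderChoices F).Nonempty :=
  ⟨F, fun _ _ => le_rfl, rfl⟩

lemma isClosed_senderChoices (F : Dist) : IsClosed (senderChoices F) := by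
  have : senderChoices F =
      (⋂ x ∈ Icc (0 : ℝ) 1, {G : Dist | ∫ q, max (x - (q : ℝ)) 0 ∂(G : Measure unitInterval) ≤
        ∫ q, max (x - (q : ℝ)) 0 ∂(F : Measure unitInterval)}) ∩
      {G : Dist | ∫ q, max (1 - (q : ℝ)) 0 ∂(G : Measure unitInterval) =
        ∫ q, max (1 - (q : ℝ)) 0 ∂(F : Measure unitInterval)} := by
    ext G
    simp only [senderChoices, mem_ofPred_eq, isMPC_iff, mem_inter_iff, mem_iInter]
  rw [this]
  exact (isClosed_biInter fun x _ =>
    isClosed_le (continuous_integral_dist (continuous_stopLoss x)) continuous_const).inter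
      (isClosed_eq (continuous_integral_dist (continuous_stopLoss 1)) continuous_const)

lemma mix_mem_senderChoices {ι : Type*} [Fintype ι] {w : ι → ℝ} (hw : w ∈ stdSimplex ℝ ι)
    {G : ι → Dist} {F : Dist} (hG : ∀ i, G i ∈ senderChoices F) :
    mix w hw G ∈ senderChoices F := by
  have hmix : ∀ x : ℝ, ∫ q, max (x - (q : ℝ)) 0 ∂(mix w hw G : Measure unitInterval) =
      ∑ i, w i * ∫ q, max (x - (q : ℝ)) 0 ∂(G i : Measure unitInterval) := fun x =>
    integral_mix hw G fun i => integrable_of_continuous _ (continuous_stopLoss x)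
  have hsum : ∀ a : ℝ, a = ∑ i, w i * a := fun a => by rw [← Finset.sum_mul, hw.2, one_mul]
  have hG' := fun i => (isMPC_iff _ _).1 (hG i)
  refine (isMPC_iff _ _).2 ⟨fun x hx => ?_, ?_⟩
  · rw [hmix, hsum (∫ q, max (x - (q : ℝ)) 0 ∂(F : Measure unitInterval))]
    exact Finset.sum_le_sum fun i _ => mul_le_mul_of_nonneg_left ((hG' i).1 x hx) (hw.1 i)
  · rw [hmix, hsum (∫ q, max (1 - (q : ℝ)) 0 ∂(F : Measure unitInterval))]
    exact Finset.sum_congr rfl fun i _ => by rw [(hG' i).2]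

/-! ### The minimax inequality -/

/-- The finite-dimensional core of the minimax theorem: if each point of a convex set has some
coordinate above `c`, one convex combination of the coordinates is at least `c` on all of it. -/
lemma exists_weights_of_convex {ι : Type*} [Fintype ι] [Nonempty ι] {S : Set (ι → ℝ)}
    (hS : Convex ℝ S) {c : ℝ} (h : ∀ z ∈ S, ∃ i, c < z i) :
    ∃ w ∈ stdSimplex ℝ ι, ∀ z ∈ S, c ≤ ∑ i, w i * z i := by
  classical
  rcases S.eq_empty_or_nonempty with rfl | ⟨z₀, hz₀⟩
  · exact ⟨Pi.single (Classical.arbitrary ι) 1, single_mem_stdSimplex ℝ _, by simp⟩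
  have hopen : IsOpen (Set.univ.pi fun _ : ι => Iio c) :=
    isOpen_set_pi finite_univ fun _ _ => isOpen_Iio
  have hconv : Convex ℝ (Set.univ.pi fun _ : ι => Iio c) := convex_pi fun _ _ => convex_Iio c
  obtain ⟨f, u, hfu, huf⟩ := geometric_hahn_banach_open hconv hopen hS
    (Set.disjoint_left.2 fun z hz hzS => by
      obtain ⟨i, hi⟩ := h z hzS
      exact lt_asymm hi (hz i trivial))
  set a : ι → ℝ := fun i => f (Pi.single i 1) with ha
  have hf : ∀ z, f z = ∑ i, a i * z i := fun z => by
    conv_lhs => rw [← Finset.univ_sum_single z]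
    rw [map_sum]
    refine Finset.sum_congr rfl fun i _ => ?_
    have : (Pi.single i (z i) : ι → ℝ) = z i • Pi.single i (1 : ℝ) := by
      rw [← Pi.single_smul]; simp
    rw [this, map_smul, smul_eq_mul, mul_comm]
  have hcs : ∀ e > 0, (∑ i, a i) * (c - e) < u := fun e he => by
    have := hfu (fun _ => c - e) fun i _ => by simpa using he
    rwa [hf, ← Finset.sum_mul] at this
  -- the open orthant is unbounded below in every coordinate, so the functional is monotone
  have ha0 : ∀ i, 0 ≤ a i := fun i => by
    by_contra! hi
    set M := (|u| + |(∑ i, a i) * (c - 1)|) / (-a i) with hM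
    have hM0 : 0 ≤ M := div_nonneg (by positivity) (by linarith)
    have hmem := hfu ((fun _ => c - 1) - Pi.single i M) fun j _ => by
      have : 0 ≤ (Pi.single i M : ι → ℝ) j := by
        by_cases hj : j = i
        · subst hj; simpa using hM0
        · simp [hj]
      simp only [Pi.sub_apply, mem_Iio]; linarith
    have hsingle : f (Pi.single i M) = a i * M := by
      rw [hf, Finset.sum_eq_single i] <;> simp +contextual
    rw [map_sub, hsingle, hf, ← Finset.sum_mul] at hmem
    have : a i * M = -(|u| + |(∑ i, a i) * (c - 1)|) := by
      rw [hM]; field_simp [hi.ne]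
    have h1 := le_abs_self u
    have h2 := neg_abs_le ((∑ i, a i) * (c - 1))
    linarith
  have hpos : 0 < ∑ i, a i := by
    refine lt_of_le_of_ne (Finset.sum_nonneg fun i _ => ha0 i) fun h0 => ?_
    have hz : ∀ i, a i = 0 := fun i =>
      (Finset.sum_eq_zero_iff_of_nonneg fun i _ => ha0 i).1 h0.symm i (Finset.mem_univ i)
    have h1 := hcs 1 one_pos
    have h2 := huf z₀ hz₀
    rw [hf] at h2
    simp only [hz, zero_mul, Finset.sum_const_zero] at h1 h2
    linarith
  have hcu : (∑ i, a i) * c ≤ u := by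
    refine le_of_forall_pos_le_add fun e he => ?_
    have := hcs (e / ∑ i, a i) (div_pos he hpos)
    rw [mul_sub, mul_div_cancel₀ _ hpos.ne'] at this
    linarith
  refine ⟨fun i => a i / ∑ i, a i, ⟨fun i => div_nonneg (ha0 i) hpos.le, ?_⟩, fun z hz => ?_⟩
  · rw [← Finset.sum_div, div_self hpos.ne']
  · have : ∑ i, a i / (∑ i, a i) * z i = f z / ∑ i, a i := by
      rw [hf, Finset.sum_div]
      exact Finset.sum_congr rfl fun i _ => div_mul_eq_mul_div _ _ _
    rw [this, le_div_iff₀ hpos, mul_comm]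
    exact hcu.trans (huf z hz)

lemma convex_payoffs {ι : Type*} (G : ι → Dist) (r : unitInterval) :
    Convex ℝ ((fun T i => senderPayoff (G i) T) '' typeDists r) := by
  rintro _ ⟨T₁, h₁, rfl⟩ _ ⟨T₂, h₂, rfl⟩ a b ha hb hab
  have hw : ![a, b] ∈ stdSimplex ℝ (Fin 2) :=
    ⟨by simp [Fin.forall_fin_two, ha, hb], by simpa using hab⟩
  refine ⟨mix _ hw ![T₁, T₂], mix_mem_typeDists hw ?_, ?_⟩
  · have h₁' : mean T₁ = r := h₁
    have h₂' : mean T₂ = r := h₂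
    simp [h₁', h₂', ← add_mul, hab]
  · ext i
    simp [senderPayoff_mix_right]

lemma bddAbove_payoffs (F T : Dist) : BddAbove ((fun G => senderPayoff G T) '' senderChoices F) :=
  ⟨1, by rintro _ ⟨G, -, rfl⟩; exact senderPayoff_le_one G T⟩

lemma bddBelow_payoffs (r : unitInterval) (G : Dist) : BddBelow (senderPayoff G '' typeDists r) :=
  ⟨0, by rintro _ ⟨T, -, rfl⟩; exact senderPayoff_nonneg G T⟩

lemma senderPayoff_le_bestPayoff {F G : Dist} (hG : G ∈ senderChoices F) (T : Dist) :
    senderPayoff G T ≤ bestPayoff F T :=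
  le_csSup (bddAbove_payoffs F T) ⟨G, hG, rfl⟩

lemma worstPayoff_le_senderPayoff {r : unitInterval} {T : Dist} (hT : T ∈ typeDists r) (G : Dist) :
    worstPayoff r G ≤ senderPayoff G T :=
  csInf_le (bddBelow_payoffs r G) ⟨T, hT, rfl⟩

/-- The nontrivial minimax inequality. It needs semicontinuity in Nature's strategy only, and so
is not affected by the payoff being lower, rather than upper, semicontinuous in Sender's. -/
lemma exists_forall_le_senderPayoff {F : Dist} {r : unitInterval} {c : ℝ}
    (h : ∀ T ∈ typeDists r, c < bestPayoff F T) :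
    ∃ G ∈ senderChoices F, ∀ T ∈ typeDists r, c ≤ senderPayoff G T := by
  obtain ⟨s, hs⟩ := (isClosed_typeDists r).isCompact.elim_finite_subcover
    (fun G : senderChoices F => {T | c < senderPayoff G T})
    (fun G => (lowerSemicontinuous_senderPayoff G.1).isOpen_preimage c) fun T hT => by
      obtain ⟨_, ⟨G, hG, rfl⟩, hcG⟩ := exists_lt_of_lt_csSup
        ((senderChoices_nonempty F).image _) (h T hT)
      exact mem_iUnion.2 ⟨⟨G, hG⟩, hcG⟩
  have hne : Nonempty s := by
    obtain ⟨T, hT⟩ := typeDists_nonempty r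
    obtain ⟨G, hG, -⟩ := mem_iUnion₂.1 (hs hT)
    exact ⟨⟨G, hG⟩⟩
  obtain ⟨w, hw, hle⟩ := exists_weights_of_convex (convex_payoffs (fun G : s => (G.1.1 : Dist)) r)
    (c := c) (by
      rintro _ ⟨T, hT, rfl⟩
      obtain ⟨G, hG, hlt⟩ := mem_iUnion₂.1 (hs hT)
      exact ⟨⟨G, hG⟩, hlt⟩)
  refine ⟨mix w hw fun G : s => (G.1.1 : Dist), mix_mem_senderChoices hw fun G => G.1.2,
    fun T hT => ?_⟩
  rw [senderPayoff_mix_left]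
  exact hle _ ⟨T, hT, rfl⟩

/-! ### Worst-case guarantees pass to weak limits -/

/-- The map `r ↦ r + t * (1 - r)`, which pushes every point but `1` strictly to the right. -/
def shift (t r : unitInterval) : unitInterval :=
  unitInterval.symm (unitInterval.symm t * unitInterval.symm r)

lemma coe_shift (t r : unitInterval) : (shift t r : ℝ) = r + t * (1 - r) := by
  simp only [shift, unitInterval.coe_symm_eq, Icc.coe_mul]; ring

lemma continuous_shift (t : unitInterval) : Continuous (shift t) := by
  unfold shift; fun_prop

/-- Beyond a shifted threshold the mass is upper semicontinuous in the distribution. At `r = 1`,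
which the shift does not move, the winning region is empty. -/
lemma limsup_measure_Ioi_shift_le {Gs : ℕ → Dist} {G : Dist} (hG : Tendsto Gs atTop (𝓝 G))
    {t : unitInterval} (ht : 0 < (t : ℝ)) (r : unitInterval) :
    limsup (fun n => (Gs n : Measure unitInterval) (Ioi (shift t r))) atTop ≤
      (G : Measure unitInterval) (Ioi r) := by
  rcases eq_or_lt_of_le r.2.2 with h1 | h1
  · have : Ioi (shift t r) = ∅ := by
      refine eq_empty_of_forall_notMem fun q hq => ?_
      have hq' : (shift t r : ℝ) < q := hq
      rw [coe_shift, h1] at hq'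
      linarith [q.2.2]
    simp [this]
  · calc limsup (fun n => (Gs n : Measure unitInterval) (Ioi (shift t r))) atTop
        ≤ limsup (fun n => (Gs n : Measure unitInterval) (Ici (shift t r))) atTop :=
          limsup_le_limsup (Eventually.of_forall fun n => measure_mono Ioi_subset_Ici_self)
      _ ≤ (G : Measure unitInterval) (Ici (shift t r)) :=
          ProbabilityMeasure.limsup_measure_closed_le_of_tendsto hG isClosed_Ici
      _ ≤ (G : Measure unitInterval) (Ioi r) := by
          refine measure_mono (Ici_subset_Ioi.2 (Subtype.coe_lt_coe.1 ?_))
          rw [coe_shift]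
          nlinarith

/-- Shifting `T` to the right and mixing with `δ₀` to restore the mean gives a competitor of `T`
against which Sender gets hardly more than the integral on the right. -/
lemma le_integral_shift_add {r : unitInterval} (hr : 0 < (r : ℝ)) {G T : Dist}
    (hT : T ∈ typeDists r) {c : ℝ} (hc : ∀ T' ∈ typeDists r, c ≤ senderPayoff G T')
    (t : unitInterval) :
    c ≤ (∫ s, (G : Measure unitInterval).real (Ioi (shift t s)) ∂(T : Measure unitInterval)) +
      t / r := by
  have hmT : mean T = r := hT
  have ht0 := t.2.1
  have hr1 := sub_nonneg.2 r.2.2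
  have hms : Measurable (shift t) := (continuous_shift t).measurable
  set T₁ : Dist := T.map hms.aemeasurable with hT₁
  set T₀ : Dist := ⟨Measure.dirac 0, inferInstance⟩ with hT₀
  have hT₁c : (T₁ : Measure unitInterval) = (T : Measure unitInterval).map (shift t) := rfl
  have hm₁ : mean T₁ = r + t * (1 - r) := by
    rw [mean, hT₁c, integral_map hms.aemeasurable
      continuous_subtype_val.aestronglyMeasurable]
    simp only [coe_shift]
    have hi : Integrable (fun s : unitInterval => (s : ℝ)) (T : Measure unitInterval) :=
      integrable_of_continuous _ continuous_subtype_val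
    have hi' : Integrable (fun s : unitInterval => (t : ℝ) * (1 - (s : ℝ)))
        (T : Measure unitInterval) := ((integrable_const _).sub hi).const_mul _
    rw [integral_add hi hi', integral_const_mul, integral_sub (integrable_const _) hi]
    change mean T + t * (_ - mean T) = _
    rw [hmT]; simp
  have hm₀ : mean T₀ = 0 := by simp [mean, hT₀]
  set D : ℝ := r + t * (1 - r) with hD
  have hrD : (r : ℝ) ≤ D := le_add_of_nonneg_right (mul_nonneg ht0 hr1)
  have hDpos : 0 < D := hr.trans_le hrD
  have hq : (r : ℝ) / D ≤ 1 := (div_le_one hDpos).2 hrD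
  have hw : ![(r : ℝ) / D, 1 - r / D] ∈ stdSimplex ℝ (Fin 2) :=
    ⟨by simp [Fin.forall_fin_two, hq, div_nonneg hr.le hDpos.le], by simp⟩
  have hmem : mix _ hw ![T₁, T₀] ∈ typeDists r := mix_mem_typeDists hw (by
    simp [hm₁, hm₀, div_mul_cancel₀ _ hDpos.ne'])
  have key := hc _ hmem
  rw [senderPayoff_mix_right] at key
  simp only [Fin.sum_univ_two, Matrix.cons_val_zero, Matrix.cons_val_one] at key
  have h₁ : senderPayoff G T₁ =
      ∫ s, (G : Measure unitInterval).real (Ioi (shift t s)) ∂(T : Measure unitInterval) := by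
    rw [senderPayoff_eq_integral, hT₁c, integral_map hms.aemeasurable
      (measurable_real_Ioi G).aestronglyMeasurable]
  have hloss : 1 - (r : ℝ) / D ≤ t / r := by
    have e : 1 - (r : ℝ) / D = t * (1 - r) / D := by
      rw [eq_div_iff hDpos.ne', sub_mul, div_mul_cancel₀ _ hDpos.ne', hD]; ring
    rw [e]
    exact div_le_div₀ ht0 (by nlinarith) hr hrD
  have a1 : (r : ℝ) / D * senderPayoff G T₁ ≤ senderPayoff G T₁ :=
    mul_le_of_le_one_left (senderPayoff_nonneg _ _) hq
  have a2 : (1 - (r : ℝ) / D) * senderPayoff G T₀ ≤ 1 - (r : ℝ) / D :=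
    mul_le_of_le_one_right (sub_nonneg.2 hq) (senderPayoff_le_one _ _)
  rw [← h₁]
  linarith

lemma le_senderPayoff_of_tendsto {r : unitInterval} (hr : 0 < (r : ℝ)) {Gs : ℕ → Dist} {G : Dist}
    (hG : Tendsto Gs atTop (𝓝 G)) {c : ℕ → ℝ} {v : ℝ} (hcv : Tendsto c atTop (𝓝 v))
    (hc : ∀ n, ∀ T ∈ typeDists r, c n ≤ senderPayoff (Gs n) T) {T : Dist} (hT : T ∈ typeDists r) :
    v ≤ senderPayoff G T := by
  have key : ∀ t : unitInterval, 0 < (t : ℝ) → v - t / r ≤ senderPayoff G T := fun t ht => by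
    rw [← ENNReal.ofReal_le_ofReal_iff (senderPayoff_nonneg G T)]
    have hlim : Tendsto (fun n => ENNReal.ofReal (c n - t / r)) atTop
        (𝓝 (ENNReal.ofReal (v - t / r))) :=
      ENNReal.tendsto_ofReal (hcv.sub_const _)
    have hmeas : ∀ n, Measurable fun s => (Gs n : Measure unitInterval).real (Ioi (shift t s)) :=
      fun n => (measurable_real_Ioi _).comp (continuous_shift t).measurable
    have hmeas' : ∀ n, Measurable fun s => (Gs n : Measure unitInterval) (Ioi (shift t s)) :=
      fun n => by simpa using (hmeas n).ennreal_ofReal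
    have hle : ∀ n, ENNReal.ofReal (c n - t / r) ≤
        ∫⁻ s, (Gs n : Measure unitInterval) (Ioi (shift t s)) ∂(T : Measure unitInterval) :=
      fun n => by
        have h := le_integral_shift_add hr hT (hc n) t
        calc ENNReal.ofReal (c n - t / r)
            ≤ ENNReal.ofReal (∫ s, (Gs n : Measure unitInterval).real (Ioi (shift t s))
                ∂(T : Measure unitInterval)) := ENNReal.ofReal_le_ofReal (by linarith)
          _ = _ := by
            rw [ofReal_integral_eq_lintegral_ofReal
              (integrable_of_bounded _ (hmeas n) 1 fun s => by
                rw [abs_of_nonneg measureReal_nonneg]; exact measureReal_le_one)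
              (Eventually.of_forall fun _ => measureReal_nonneg)]
            simp
    rw [← hlim.limsup_eq, ofReal_senderPayoff]
    calc limsup (fun n => ENNReal.ofReal (c n - t / r)) atTop
        ≤ limsup (fun n => ∫⁻ s, (Gs n : Measure unitInterval) (Ioi (shift t s))
            ∂(T : Measure unitInterval)) atTop := limsup_le_limsup (Eventually.of_forall hle)
      _ ≤ ∫⁻ s, limsup (fun n => (Gs n : Measure unitInterval) (Ioi (shift t s))) atTop
            ∂(T : Measure unitInterval) :=
          limsup_lintegral_le (fun _ => 1) hmeas'
            (fun n => Eventually.of_forall fun s => prob_le_one) (by simp)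
      _ ≤ ∫⁻ s, (G : Measure unitInterval) (Ioi s) ∂(T : Measure unitInterval) :=
          lintegral_mono fun s => limsup_measure_Ioi_shift_le hG ht s
  refine le_of_forall_pos_le_add fun e he => ?_
  have hpos : 0 < min 1 (e * r) := lt_min one_pos (mul_pos he hr)
  have h := key ⟨min 1 (e * r), hpos.le, min_le_left _ _⟩ hpos
  have h2 : min 1 (e * r) / (r : ℝ) ≤ e := (div_le_iff₀ hr).2 (min_le_right _ _)
  simp only at h
  linarith

/-! ### Saddle points -/

lemma isLeast_worstPayoff (r : unitInterval) (G : Dist) :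
    IsLeast (senderPayoff G '' typeDists r) (worstPayoff r G) := by
  obtain ⟨T, hT, hmin⟩ := (lowerSemicontinuous_senderPayoff G).lowerSemicontinuousOn
    (typeDists r) |>.exists_isMinOn (typeDists_nonempty r) (isClosed_typeDists r).isCompact
  have h : IsLeast (senderPayoff G '' typeDists r) (senderPayoff G T) :=
    ⟨⟨T, hT, rfl⟩, by rintro _ ⟨T', hT', rfl⟩; exact hmin hT'⟩
  rw [worstPayoff, h.csInf_eq]
  exact h

lemma lowerSemicontinuous_bestPayoff (F : Dist) : LowerSemicontinuous (bestPayoff F) := by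
  intro T c hc
  obtain ⟨_, ⟨G, hG, rfl⟩, hcG⟩ := exists_lt_of_lt_csSup ((senderChoices_nonempty F).image _) hc
  filter_upwards [lowerSemicontinuous_senderPayoff G T c hcG] with T' h
  exact lt_of_lt_of_le h (senderPayoff_le_bestPayoff hG T')

lemma exists_saddlePoint (F : Dist) {r : unitInterval} (hr : 0 < (r : ℝ)) :
    ∃ G ∈ senderChoices F, ∃ T ∈ typeDists r,
      worstPayoff r G = bestPayoff F T := by
  obtain ⟨T, hT, hmin⟩ := (lowerSemicontinuous_bestPayoff F).lowerSemicontinuousOn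
    (typeDists r) |>.exists_isMinOn (typeDists_nonempty r) (isClosed_typeDists r).isCompact
  set v := bestPayoff F T with hv
  have hex : ∀ n : ℕ, ∃ G ∈ senderChoices F, ∀ T' ∈ typeDists r,
      v - 1 / ((n : ℝ) + 1) ≤ senderPayoff G T' := fun n =>
    exists_forall_le_senderPayoff fun T' hT' =>
      (sub_lt_self v Nat.one_div_pos_of_nat).trans_le (hmin hT')
  choose Gs hGs hle using hex
  obtain ⟨G, hG, φ, hφ, hlim⟩ := (isClosed_senderChoices F).isCompact.tendsto_subseq hGs
  have hcv : Tendsto (fun n : ℕ => v - 1 / ((n : ℝ) + 1)) atTop (𝓝 v) := by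
    simpa using tendsto_one_div_add_atTop_nhds_zero_nat.const_sub v
  refine ⟨G, hG, T, hT, le_antisymm
    ((worstPayoff_le_senderPayoff hT G).trans (senderPayoff_le_bestPayoff hG T)) ?_⟩
  refine le_csInf ((typeDists_nonempty r).image _) ?_
  rintro _ ⟨T', hT', rfl⟩
  exact le_senderPayoff_of_tendsto hr hlim (hcv.comp hφ.tendsto_atTop) (fun n => hle (φ n)) hT'

end MaxminPersuasion

open MaxminPersuasion in
theorem lemmaA1 (F : MaxminPersuasion.Dist)
    (hF : MaxminPersuasion.mean F ∈ Set.Ioo (0 : ℝ) 1)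
    (r : unitInterval) (hr : (r : ℝ) ∈ Set.Ioo (0 : ℝ) 1) :
    -- Nash equilibrium strategies of Sender are exactly the maxmin solutions
    (∀ G ∈ MaxminPersuasion.senderChoices F,
      MaxminPersuasion.IsSenderNashStrategy F r G ↔ MaxminPersuasion.SolvesMaxmin F r G) ∧
    -- the inner minimum of the maxmin problem is attained
    (∀ G ∈ MaxminPersuasion.senderChoices F,
      IsLeast (MaxminPersuasion.senderPayoff G '' MaxminPersuasion.typeDists r)
        (MaxminPersuasion.worstPayoff r G)) ∧
    -- the maxmin and the minmax value exist and coincide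
    (∃ v : ℝ,
      IsGreatest (MaxminPersuasion.worstPayoff r '' MaxminPersuasion.senderChoices F) v ∧
      IsLeast (MaxminPersuasion.bestPayoff F '' MaxminPersuasion.natureChoices r) v) := by
  obtain ⟨G₀, hG₀, T₀, hT₀, hval⟩ := exists_saddlePoint F hr.1
  have hweak : ∀ G ∈ senderChoices F, ∀ T ∈ typeDists r, worstPayoff r G ≤ bestPayoff F T :=
    fun G hG T hT => (worstPayoff_le_senderPayoff hT G).trans (senderPayoff_le_bestPayoff hG T)
  refine ⟨fun G hG => ⟨?_, ?_⟩, fun G _ => isLeast_worstPayoff r G, worstPayoff r G₀,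
    ⟨⟨G₀, hG₀, rfl⟩, ?_⟩, ⟨⟨T₀, ?_, hval.symm⟩, ?_⟩⟩
  · rintro ⟨T, -, hT, hs, hn⟩
    rw [natureChoices_eq_typeDists] at hT hn
    refine ⟨hG, fun G' hG' => ?_⟩
    refine ((worstPayoff_le_senderPayoff hT G').trans (hs G' hG')).trans
      (le_csInf ((typeDists_nonempty r).image _) ?_)
    rintro _ ⟨T', hT', rfl⟩
    exact neg_le_neg_iff.1 (hn T' hT')
  · rintro ⟨-, hmax⟩
    have hbest : bestPayoff F T₀ ≤ worstPayoff r G := hval ▸ hmax G₀ hG₀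
    refine ⟨T₀, hG, by rwa [natureChoices_eq_typeDists], fun G' hG' => ?_, fun T' hT' => ?_⟩
    · exact (senderPayoff_le_bestPayoff hG' T₀).trans
        (hbest.trans (worstPayoff_le_senderPayoff hT₀ G))
    · rw [natureChoices_eq_typeDists] at hT'
      exact neg_le_neg ((senderPayoff_le_bestPayoff hG T₀).trans
        (hbest.trans (worstPayoff_le_senderPayoff hT' G)))
  · rintro _ ⟨G, hG, rfl⟩
    exact hval ▸ hweak G hG T₀ hT₀
  · rwa [natureChoices_eq_typeDists]
  · rintro _ ⟨T, hT, rfl⟩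
    rw [natureChoices_eq_typeDists] at hT
    exact hweak G₀ hG₀ T hT
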